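/- Let $d,n\in\mathbb N$, let $\mathcal E$ be a finite set of pairs of elements of $\{1,\dots,n\}$, $A\in\mathbb R^{d\times n}$, $\tilde Z\in\mathbb R^{d\times|\mathcal E|}$, $\sigma>0$, and let $\mathcal B(X)=[x_i-x_j]_{(i,j)\in\mathcal E}$ for $X=[x_1,\dots,x_n]\in\mathbb R^{d\times n}$; all matrix spaces carry the Frobenius inner product and norm. Let $p:\mathbb R^{d\times|\mathcal E|}\to(-\infty,+\infty]$ be proper, closed and convex, put $\operatorname{Prox}_{tp}(x)=\arg\min_u\{tp(u)+\tfrac12\|u-x\|^2\}$ and $$\phi(X)=\inf_U\Big\{\tfrac12\|X-A\|^2+p(U)+\langle\tilde Z,\mathcal B(X)-U\rangle+\tfrac\sigma2\|\mathcal B(X)-U\|^2\Big\},$$ $$\hat\partial^2\phi(X)=\{\mathcal I+\sigma\mathcal B^*(\mathcal I-\mathcal P)\mathcal B:\ \mathcal P\in\partial\operatorname{Prox}_{p/\sigma}(\sigma^{-1}\tilde Z+\mathcal B(X))\},$$ where $\partial$ is the Clarke generalized Jacobian. Assume that $F=\operatorname{Prox}_{p/\sigma}$ is strongly semismooth on $\operatorname{int}(\operatorname{dom}p)$,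 i.e. it is locally Lipschitz there and, at every $x\in\operatorname{int}(\operatorname{dom}p)$, it is directionally differentiable and, uniformly over $V\in\partial F(x+h)$, $F(x+h)-F(x)-Vh$ is $o(\|h\|)$ and $O(\|h\|^2)$ as $h\to0$. Let $\mu\in(0,1/2)$, $\tau\in(0,1]$, $\bar\eta,\delta\in(0,1)$, $X^0\in\mathbb R^{d\times n}$ arbitrary, and let $\{X^j\}$ be generated by the semismooth Newton-CG method: if $\nabla\phi(X^j)=0$, then $X^{j+1}=X^j$ (the method stops); otherwise, for some $V_j\in\hat\partial^2\phi(X^j)$, $d^j$ is an iterate of the conjugate gradient method, started at $0$, for $V_jd=-\nabla\phi(X^j)$ with $$\|V_jd^j+\nabla\phi(X^j)\|\le\min(\bar\eta,\|\nabla\phi(X^j)\|^{1+\tau}),$$ $m_j$ is the first nonnegative integer $m$ with $\phi(X^j+\delta^md^j)<\phi(X^j)+\mu\delta^m\langle\nabla\phi(X^j),d^j\rangle$, and $X^{j+1}=X^j+\delta^{m_j}d^j$. Then $\phi$ is differentiable, $\nabla\phi(X)=0$ has a unique solution $\bar X$, and $X^j\to\bar X$. Moreover, if $\sigma^{-1}\tilde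 Z+\mathcal B(\bar X)\in\operatorname{int}(\operatorname{dom}p)$, which holds automatically when $p$ is finite everywhere, in particular for the penalty $p(U)=\gamma\sum_{(i,j)\in\mathcal E}w_{ij}\|U^{(i,j)}\|$ with $\gamma>0$ and $w_{ij}\ge0$, then $$\|X^{j+1}-\bar X\|=O(\|X^j-\bar X\|^{1+\tau})\quad(j\to\infty).$$ -/

import Mathlib

open Filter Topology Asymptotics

namespace SSNCG

noncomputable section

/-! ### Generalized Jacobians and strong semismoothness -/

section Semismooth

variable {E F : Type*} [NormedAddCommGroup E] [NormedSpace ℝ E]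
  [NormedAddCommGroup F] [NormedSpace ℝ F]

/-- The B-subdifferential of `G` at `x`: all limits of derivatives `G'(u k)` along sequences
`u k → x` of points at which `G` is differentiable. -/
def bSubdifferential (G : E → F) (x : E) : Set (E →L[ℝ] F) :=
  {V | ∃ u : ℕ → E, Tendsto u atTop (𝓝 x) ∧ (∀ k, DifferentiableAt ℝ G (u k)) ∧
    Tendsto (fun k => fderiv ℝ G (u k)) atTop (𝓝 V)}

/-- The Clarke generalized Jacobian `∂G(x)`. -/
def clarkeJacobian (G : E → F) (x : E) : Set (E →L[ℝ] F) :=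
  convexHull ℝ (bSubdifferential G x)

/-- One-sided directional differentiability of `G` at `x`, in every direction. -/
def DirectionallyDifferentiableAt (G : E → F) (x : E) : Prop :=
  ∀ h : E, ∃ y : F, Tendsto (fun t : ℝ => t⁻¹ • (G (x + t • h) - G x)) (𝓝[>] 0) (𝓝 y)

/-- Semismoothness at a point (for `G` locally Lipschitz near that point):
`G(x + h) - G(x) - V h = o(‖h‖)` for `V ∈ ∂G(x + h)`, `h → 0`. -/
def SemismoothAt (G : E → F) (x : E) : Prop :=
  DirectionallyDifferentiableAt G x ∧
    ∀ ε > 0, ∃ ρ > 0, ∀ h : E, ‖h‖ < ρ → ∀ V ∈ clarkeJacobian G (x + h),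
      ‖G (x + h) - G x - V h‖ ≤ ε * ‖h‖

/-- Strong semismoothness at a point: semismooth, and
`G(x + h) - G(x) - V h = O(‖h‖²)` for `V ∈ ∂G(x + h)`, `h → 0`. -/
def StronglySemismoothAt (G : E → F) (x : E) : Prop :=
  SemismoothAt G x ∧
    ∃ C : ℝ, ∃ ρ > 0, ∀ h : E, ‖h‖ < ρ → ∀ V ∈ clarkeJacobian G (x + h),
      ‖G (x + h) - G x - V h‖ ≤ C * ‖h‖ ^ 2

/-- `G` is a (locally Lipschitz) strongly semismooth function on the set `O` (used for open `O`). -/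
def StronglySemismoothOn (G : E → F) (O : Set E) : Prop :=
  LocallyLipschitzOn O G ∧ ∀ x ∈ O, StronglySemismoothAt G x

end Semismooth

/-! ### Closed proper convex functions and proximal mappings

An extended-real-valued function is given by its effective domain `D` and its finite values on `D`;
it is `+∞` outside `D`, and the values of `p` outside `D` are never used. -/

section Prox

variable {F : Type*} [NormedAddCommGroup F] [InnerProductSpace ℝ F]

/-- `p`, with effective domain `D`, is proper, convex and closed (its epigraph is closed). -/
structure ClosedProperConvex (D : Set F) (p : F → ℝ) : Prop where
  nonempty : D.Nonempty
  convexOn : ConvexOn ℝ D p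
  isClosed_epigraph : IsClosed {q : F × ℝ | q.1 ∈ D ∧ p q.1 ≤ q.2}

/-- `u` minimizes `t p(u) + ½ ‖u - x‖²`. -/
def IsProxPoint (D : Set F) (p : F → ℝ) (t : ℝ) (x u : F) : Prop :=
  IsMinOn (fun v => t * p v + 1 / 2 * ‖v - x‖ ^ 2) D u ∧ u ∈ D

/-- `Prox_{tp}(x) = argmin_u { t p(u) + ½ ‖u - x‖² }`. -/
def prox (D : Set F) (p : F → ℝ) (t : ℝ) (x : F) : F :=
  Classical.epsilon (IsProxPoint D p t x)

end Prox

/-! ### The conjugate gradient method -/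

section CG

variable {E : Type*} [NormedAddCommGroup E] [InnerProductSpace ℝ E]

/-- State of the CG method: current iterate, residual and search direction. -/
structure CGState (E : Type*) where
  iter : E
  res : E
  dir : E

/-- One step of the CG method for the linear system `V d = b`
(once the residual vanishes, the iterate no longer changes). -/
def cgStep (V : E →L[ℝ] E) (s : CGState E) : CGState E :=
  let a : ℝ := ‖s.res‖ ^ 2 / inner ℝ s.dir (V s.dir)
  let r : E := s.res - a • V s.dir
  { iter := s.iter + a • s.dir
    res := r
    dir := r + (‖r‖ ^ 2 / ‖s.res‖ ^ 2) • s.dir }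

/-- The `k`-th iterate of the CG method for `V d = b`, started at `d = 0`. -/
def cgIterate (V : E →L[ℝ] E) (b : E) (k : ℕ) : E :=
  ((cgStep V)^[k] { iter := 0, res := b, dir := b }).iter

end CG

/-! ### The subproblem of the augmented Lagrangian method and the algorithm SSNCG -/

section Algorithm

variable {E F : Type*} [NormedAddCommGroup E] [InnerProductSpace ℝ E] [CompleteSpace E]
  [NormedAddCommGroup F] [InnerProductSpace ℝ F] [CompleteSpace F]

/-- The augmented Lagrangian
`½‖X - A‖² + p(U) + ⟨Z, B X - U⟩ + (σ/2) ‖B X - U‖²`, for `U` in the domain of `p`. -/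
def augLagrangian (A : E) (B : E →L[ℝ] F) (p : F → ℝ) (σ : ℝ) (Z : F) (X : E) (U : F) : ℝ :=
  1 / 2 * ‖X - A‖ ^ 2 + p U + inner ℝ Z (B X - U) + σ / 2 * ‖B X - U‖ ^ 2

/-- `φ(X) = inf_U Φ(X, U)`. -/
def phi (A : E) (B : E →L[ℝ] F) (D : Set F) (p : F → ℝ) (σ : ℝ) (Z : F) (X : E) : ℝ :=
  ⨅ U : D, augLagrangian A B p σ Z X U

/-- The set `{ I + σ B* (I - P) B | P ∈ ∂Prox_{p/σ}(Z/σ + B X) }` of generalized Hessians. -/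
def genHessian (B : E →L[ℝ] F) (D : Set F) (p : F → ℝ) (σ : ℝ) (Z : F) (X : E) :
    Set (E →L[ℝ] E) :=
  {V | ∃ P ∈ clarkeJacobian (prox D p σ⁻¹) (σ⁻¹ • Z + B X),
    V = ContinuousLinearMap.id ℝ E +
      σ • ((ContinuousLinearMap.adjoint B).comp ((ContinuousLinearMap.id ℝ F - P).comp B))}

/-- One iteration `X ↦ X'` of the semismooth Newton-CG method for `∇f(X) = 0`, with generalized
Hessians `H` and parameters `μ, τ, η, δ`. If `∇f(X) = 0` already, the method stops at `X`.
Otherwise `d` is a CG iterate for `V d = -∇f(X)` with sufficiently small residual, and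
`m` is the first nonnegative integer that passes the line search test. -/
def SSNCGStep (f : E → ℝ) (H : E → Set (E →L[ℝ] E)) (μ τ η δ : ℝ) (X X' : E) : Prop :=
  (gradient f X = 0 ∧ X' = X) ∨
  (gradient f X ≠ 0 ∧
    ∃ V ∈ H X, ∃ d : E, (∃ k : ℕ, d = cgIterate V (-gradient f X) k) ∧
      ‖V d + gradient f X‖ ≤ min η (‖gradient f X‖ ^ (1 + τ)) ∧
      ∃ m : ℕ,
        IsLeast {m : ℕ | f (X + δ ^ m • d) < f X + μ * δ ^ m * inner ℝ (gradient f X) d} m ∧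
        X' = X + δ ^ m • d)

end Algorithm

/-! ### The convex clustering setting -/

/-- Real matrices with `d` rows and columns indexed by `ι`, stored by columns, with the Frobenius
norm and inner product. -/
abbrev ColMatrix (d : ℕ) (ι : Type) [Fintype ι] : Type :=
  PiLp 2 (fun _ : ι => EuclideanSpace ℝ (Fin d))

/-- The operator `B(X) = [x_i - x_j]_{(i,j) ∈ 𝓔}`. -/
def edgeDiff (d : ℕ) {n : ℕ} (𝓔 : Finset (Fin n × Fin n)) :
    ColMatrix d (Fin n) →L[ℝ] ColMatrix d 𝓔 where
  toFun X := WithLp.toLp 2 (fun e : 𝓔 => X e.1.1 - X e.1.2)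
  map_add' X Y := PiLp.ext fun e => add_sub_add_comm (X e.1.1) (Y e.1.1) (X e.1.2) (Y e.1.2)
  map_smul' c X := PiLp.ext fun e => (smul_sub c (X e.1.1) (X e.1.2)).symm
  cont := by fun_prop

end

end SSNCG

/-! Completing the square in `U` writes `φ(X)` as `½‖X - A‖²` plus `σ` times the Moreau envelope of
`p/σ` at `σ⁻¹Z + BX`, up to a constant. The envelope is convex with gradient `x - prox x`, so `φ` is
1-strongly convex with `L`-Lipschitz gradient `g`, `L = 1 + σ‖B‖²` (`smoothStrongConvex_phi`).
Derivatives of `prox` are symmetric with spectrum in `[0, 1]`, hence every generalized Hessian lies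
between `I` and `L·I`.

Global convergence: a nonzero-index CG iterate is a uniform descent direction
(`norm_sq_le_inner_cgIterate`), so backtracking steps stay bounded below and each step lowers `φ` by
at least `c‖g‖²` (`step_decrease`). As `φ` is bounded below, `g(X^j) → 0`, and strong convexity
gives `X^j → X̄`.

Rate: strong semismoothness of `prox` at `σ⁻¹Z + BX̄` gives `g(Y) - V(Y - X̄) = O(‖Y - X̄‖²)`; with
`V ≥ I` and the residual test, the full step has error `O(‖X^j - X̄‖^(1+τ))`. The full step is
eventually accepted because `μ < 1/2` and `φ` has a second-order expansion at `X̄`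
(`half_inner_le`). -/

namespace SSNCG

/-! ### Proximal points and the Moreau envelope -/

section Prox

variable {F : Type*} [NormedAddCommGroup F] [InnerProductSpace ℝ F]
  {D : Set F} {p : F → ℝ} {t : ℝ}

/-- A closed proper convex function has an affine minorant. -/
theorem ClosedProperConvex.exists_affine_minorant (hp : ClosedProperConvex D p) :
    ∃ (a : F →L[ℝ] ℝ) (c : ℝ), ∀ v ∈ D, a v + c ≤ p v := by
  obtain ⟨x₀, hx₀⟩ := hp.nonempty
  obtain ⟨f, u, hfu, huf⟩ := geometric_hahn_banach_point_closed
    (x := (x₀, p x₀ - 1)) hp.convexOn.convex_epigraph hp.isClosed_epigraph (by simp [hx₀])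
  have hdec : ∀ v s, f (v, s) = f (v, 0) + s * f (0, 1) := by
    intro v s
    rw [← smul_eq_mul, ← map_smul, ← map_add]
    simp
  set b := f (0, 1) with hb
  -- The separating hyperplane is not vertical: it separates `(x₀, p x₀ - 1)` from `(x₀, p x₀)`.
  have hbpos : 0 < b := by
    have h1 := hfu.trans (huf (x₀, p x₀) ⟨hx₀, le_rfl⟩)
    rw [hdec, hdec x₀ (p x₀)] at h1
    linarith
  refine ⟨-(b⁻¹ • (f.comp (ContinuousLinearMap.inl ℝ F ℝ))), u / b, fun v hv => ?_⟩
  have h2 := huf (v, p v) ⟨hv, le_rfl⟩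
  rw [hdec] at h2
  have h3 : (u - f (v, 0)) / b ≤ p v := by
    rw [div_le_iff₀ hbpos]; linarith
  have h4 : (-(b⁻¹ • (f.comp (ContinuousLinearMap.inl ℝ F ℝ)))) v + u / b
      = (u - f (v, 0)) / b := by
    simp; field_simp; ring
  rw [h4]; exact h3

/-- Minimizing `t * s + ½‖v - x‖²` over the closed epigraph makes the objective continuous; the
affine minorant makes its sublevel set compact. -/
theorem ClosedProperConvex.exists_isProxPoint [FiniteDimensional ℝ F]
    (hp : ClosedProperConvex D p) (ht : 0 < t) (x : F) : ∃ u, IsProxPoint D p t x u := by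
  obtain ⟨a, c, hac⟩ := hp.exists_affine_minorant
  obtain ⟨x₀, hx₀⟩ := hp.nonempty
  set h : F × ℝ → ℝ := fun q => t * q.2 + 1 / 2 * ‖q.1 - x‖ ^ 2 with hh
  have hcont : Continuous h := by fun_prop
  set C := h (x₀, p x₀) with hC
  set K : Set (F × ℝ) := {q | q.1 ∈ D ∧ p q.1 ≤ q.2} ∩ {q | h q ≤ C} with hK
  have hclosed : IsClosed K := hp.isClosed_epigraph.inter (isClosed_le hcont continuous_const)
  -- On the sublevel set `½w² ≤ t‖a‖w + |C - t(a x + c)|` with `w = ‖v - x‖`. The summand 1 gives `w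
  -- ≥ 1` when `w > R`, so the constant is absorbed into the linear term.
  set R := 1 + 2 * (t * ‖a‖) + 2 * |C - t * (a x + c)| with hR
  have hsub : K ⊆ Metric.closedBall x R ×ˢ Set.Icc (a x + c - ‖a‖ * R) (C / t) := by
    rintro ⟨v, s⟩ ⟨⟨hv, hvs⟩, hvC⟩
    simp only [hh, Set.mem_ofPred_eq] at hv hvs hvC
    have h1 := hac v hv
    have h2 : -(‖a‖ * ‖v - x‖) ≤ a v - a x := by
      rw [← map_sub]
      exact (abs_le.mp ((Real.norm_eq_abs _).symm.trans_le (a.le_opNorm _))).1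
    have ha := norm_nonneg a
    have hw := norm_nonneg (v - x)
    have h3 : a x + c - ‖a‖ * ‖v - x‖ ≤ s := by linarith
    have h4 := mul_le_mul_of_nonneg_left h3 ht.le
    have h5 := le_abs_self (C - t * (a x + c))
    have hta : 0 ≤ t * ‖a‖ := by positivity
    have hwR : ‖v - x‖ ≤ R := by
      by_contra hcon
      push Not at hcon
      have h6 := abs_nonneg (C - t * (a x + c))
      have h7 : 1 ≤ ‖v - x‖ := by linarith
      have h8 := mul_le_mul_of_nonneg_right h7 h6
      nlinarith
    refine ⟨by simpa [dist_eq_norm] using hwR, ?_, ?_⟩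
    · have := mul_le_mul_of_nonneg_left hwR ha
      simp only; linarith
    · simp only
      rw [le_div_iff₀ ht]
      have : 0 ≤ 1 / 2 * ‖v - x‖ ^ 2 := by positivity
      linarith
  have hcomp : IsCompact K :=
    ((isCompact_closedBall x R).prod isCompact_Icc).of_isClosed_subset hclosed hsub
  obtain ⟨⟨u, s⟩, hus, hmin⟩ := hcomp.exists_isMinOn
    ⟨(x₀, p x₀), ⟨hx₀, le_rfl⟩, le_refl C⟩ hcont.continuousOn
  have huD : u ∈ D := hus.1.1
  have hps : p u ≤ s := hus.1.2
  refine ⟨u, fun v hv => ?_, huD⟩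
  have hle : h (u, p u) ≤ h (u, s) := by
    simp only [hh]
    have := mul_le_mul_of_nonneg_left hps ht.le
    linarith
  change h (u, p u) ≤ h (v, p v)
  by_cases hvC : h (v, p v) ≤ C
  · exact hle.trans (hmin ⟨⟨hv, le_rfl⟩, hvC⟩)
  · exact hle.trans (hus.2.trans (not_le.mp hvC).le)

theorem ClosedProperConvex.isProxPoint_prox [FiniteDimensional ℝ F]
    (hp : ClosedProperConvex D p) (ht : 0 < t) (x : F) : IsProxPoint D p t x (prox D p t x) :=
  Classical.epsilon_spec (hp.exists_isProxPoint ht x)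

/-- The variational inequality characterizing proximal points. -/
theorem IsProxPoint.add_inner_le (hp : ConvexOn ℝ D p) (ht : 0 < t) {x u v : F}
    (hu : IsProxPoint D p t x u) (hv : v ∈ D) :
    t * p u + inner ℝ (x - u) (v - u) ≤ t * p v := by
  obtain ⟨hmin, huD⟩ := hu
  by_contra hcon
  push Not at hcon
  set K := t * p v - t * p u - inner ℝ (x - u) (v - u) with hK
  have hKneg : K < 0 := by linarith
  set N := ‖v - u‖ ^ 2 with hN
  have hN0 : 0 ≤ N := by positivity
  -- Moving a fraction `s` from `u` to `v` changes the objective by at most `s(K + sN/2)`. This `s ≤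
  -- 1` gives `K + sN/2 = K(1 + s)/2 < 0`, contradicting minimality.
  set s := -K / (N - K) with hs
  have hNK : 0 < N - K := by linarith
  have hs0 : 0 < s := div_pos (by linarith) hNK
  have hs1 : s ≤ 1 := (div_le_one hNK).2 (by linarith)
  have hsN : s * (N - K) = -K := div_mul_cancel₀ _ hNK.ne'
  have hmem : (1 - s) • u + s • v ∈ D :=
    hp.1 huD hv (by linarith) hs0.le (by ring)
  have h1 := hmin hmem
  simp only [Set.mem_ofPred_eq] at h1
  have h2 := hp.2 huD hv (by linarith : 0 ≤ 1 - s) hs0.le (by ring)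
  simp only [smul_eq_mul] at h2
  have h3 : ‖(1 - s) • u + s • v - x‖ ^ 2
      = ‖u - x‖ ^ 2 - 2 * s * inner ℝ (x - u) (v - u) + s ^ 2 * N := by
    have : (1 - s) • u + s • v - x = s • (v - u) - (x - u) := by module
    rw [this, norm_sub_sq_real, norm_smul, inner_smul_left, norm_sub_rev u x,
      real_inner_comm (x - u) (v - u), mul_pow, Real.norm_eq_abs, sq_abs]
    simp only [conj_trivial]
    ring
  rw [h3] at h1
  have h4 := mul_le_mul_of_nonneg_left h2 ht.le
  have h5 : 0 ≤ s * (K + s * N / 2) := by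
    simp only [hK]
    linarith
  have h6 : 0 ≤ K + s * N / 2 := nonneg_of_mul_nonneg_right h5 hs0
  have h7 : 0 < s * -K := mul_pos hs0 (by linarith)
  linarith

section FiniteDimensional

variable [FiniteDimensional ℝ F]

/-- The proximal mapping is firmly nonexpansive. -/
theorem ClosedProperConvex.prox_firmlyNonexpansive (hp : ClosedProperConvex D p) (ht : 0 < t)
    (x y : F) : ‖prox D p t x - prox D p t y‖ ^ 2
      ≤ inner ℝ (prox D p t x - prox D p t y) (x - y) := by
  have hx := hp.isProxPoint_prox ht x
  have hy := hp.isProxPoint_prox ht y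
  have h1 := hx.add_inner_le hp.convexOn ht hy.2
  have h2 := hy.add_inner_le hp.convexOn ht hx.2
  set u := prox D p t x
  set w := prox D p t y
  have h3 : inner ℝ (x - u) (w - u) + inner ℝ (y - w) (u - w)
      = ‖u - w‖ ^ 2 - inner ℝ (u - w) (x - y) := by
    rw [← real_inner_self_eq_norm_sq]
    simp only [inner_sub_left, inner_sub_right, real_inner_comm]
    ring
  linarith

theorem ClosedProperConvex.norm_prox_sub_le (hp : ClosedProperConvex D p) (ht : 0 < t)
    (x y : F) : ‖prox D p t x - prox D p t y‖ ≤ ‖x - y‖ := by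
  have h1 := hp.prox_firmlyNonexpansive ht x y
  have h2 := real_inner_le_norm (prox D p t x - prox D p t y) (x - y)
  by_contra hcon
  push Not at hcon
  have := norm_nonneg (x - y)
  nlinarith

/-- The Moreau envelope `x ↦ min_u { t p(u) + ½ ‖u - x‖² }`. -/
noncomputable def moreau (D : Set F) (p : F → ℝ) (t : ℝ) (x : F) : ℝ :=
  t * p (prox D p t x) + 1 / 2 * ‖prox D p t x - x‖ ^ 2

theorem ClosedProperConvex.moreau_le (hp : ClosedProperConvex D p) (ht : 0 < t) (x : F)
    {v : F} (hv : v ∈ D) : moreau D p t x ≤ t * p v + 1 / 2 * ‖v - x‖ ^ 2 :=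
  (hp.isProxPoint_prox ht x).1 hv

/-- The proximal point of `x` is a competitor in the problem at `y`. -/
theorem ClosedProperConvex.moreau_upper (hp : ClosedProperConvex D p) (ht : 0 < t) (x y : F) :
    moreau D p t y ≤ moreau D p t x + inner ℝ (x - prox D p t x) (y - x)
      + 1 / 2 * ‖y - x‖ ^ 2 := by
  have h := hp.moreau_le ht y (hp.isProxPoint_prox ht x).2
  have h2 : ‖prox D p t x - y‖ ^ 2 = ‖prox D p t x - x‖ ^ 2
      + 2 * inner ℝ (x - prox D p t x) (y - x) + ‖y - x‖ ^ 2 := by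
    have : prox D p t x - y = -((x - prox D p t x) + (y - x)) := by abel
    rw [this, norm_neg, norm_add_sq_real, norm_sub_rev x]
  rw [h2] at h
  unfold moreau at *
  linarith

/-- The variational inequality at `x`, tested with the proximal point of `y`, leaves a slack of half
the square of `(y - w) - (x - u)`. -/
theorem ClosedProperConvex.moreau_lower (hp : ClosedProperConvex D p) (ht : 0 < t) (x y : F) :
    moreau D p t x + inner ℝ (x - prox D p t x) (y - x) ≤ moreau D p t y := by
  have h := (hp.isProxPoint_prox ht x).add_inner_le hp.convexOn ht (hp.isProxPoint_prox ht y).2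
  unfold moreau
  set u := prox D p t x
  set w := prox D p t y
  have h1 : y - x = (y - w) - (x - u) + (w - u) := by abel
  have h2 : 0 ≤ ‖(y - w) - (x - u)‖ ^ 2 := by positivity
  rw [norm_sub_sq_real] at h2
  rw [h1, inner_add_right, inner_sub_right, real_inner_self_eq_norm_sq, norm_sub_rev u x,
    norm_sub_rev w y, real_inner_comm]
  linarith

end FiniteDimensional

end Prox

/-- A function with a quadratic bound on its first order remainder is differentiable. -/
theorem hasGradientAt_of_quadratic_bound {E : Type*} [NormedAddCommGroup E]
    [InnerProductSpace ℝ E] [CompleteSpace E] {f : E → ℝ} {x g : E} {C : ℝ}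
    (h : ∀ y, |f y - f x - inner ℝ g (y - x)| ≤ C * ‖y - x‖ ^ 2) : HasGradientAt f g x := by
  rw [hasGradientAt_iff_isLittleO]
  have h1 : (fun y => f y - f x - inner ℝ g (y - x)) =O[𝓝 x] (fun y => ‖y - x‖ ^ 2) :=
    IsBigO.of_bound C (Eventually.of_forall fun y => by simpa using h y)
  refine h1.trans_isLittleO ?_
  have h2 : Tendsto (fun y => ‖y - x‖) (𝓝 x) (𝓝 0) := by
    have : Continuous fun y => ‖y - x‖ := by fun_prop
    simpa using this.tendsto x
  have h3 := ((isLittleO_one_iff ℝ).2 h2).mul_isBigO (isBigO_refl (fun y => ‖y - x‖) (𝓝 x))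
  simp only [one_mul, ← sq] at h3
  exact isLittleO_norm_right.1 h3

/-! ### Spectrum of the Clarke Jacobian of `prox` -/

section Clarke

variable {F : Type*} [NormedAddCommGroup F] [InnerProductSpace ℝ F] [FiniteDimensional ℝ F]
  {D : Set F} {p : F → ℝ} {t : ℝ}

theorem ClosedProperConvex.hasGradientAt_moreau (hp : ClosedProperConvex D p) (ht : 0 < t)
    (x : F) : HasGradientAt (moreau D p t) (x - prox D p t x) x := by
  refine hasGradientAt_of_quadratic_bound (C := 1 / 2) fun y => ?_
  rw [abs_le]
  have h1 := hp.moreau_lower ht x y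
  have h2 := hp.moreau_upper ht x y
  have h3 : 0 ≤ ‖y - x‖ ^ 2 := by positivity
  constructor <;> linarith

/-- Derivatives of the proximal mapping are symmetric. -/
theorem ClosedProperConvex.fderiv_prox_symm (hp : ClosedProperConvex D p) (ht : 0 < t)
    {x : F} (hx : DifferentiableAt ℝ (prox D p t) x) (v w : F) :
    inner ℝ (fderiv ℝ (prox D p t) x v) w = inner ℝ v (fderiv ℝ (prox D p t) x w) := by
  -- `I - prox'(x)` is a second derivative of the envelope, hence symmetric.
  have h1 : ∀ y, HasFDerivAt (moreau D p t) (innerSL ℝ (y - prox D p t y)) y := fun y =>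
    (hp.hasGradientAt_moreau ht y).hasFDerivAt
  have h2 : HasFDerivAt (fun y => innerSL ℝ (y - prox D p t y))
      ((innerSL ℝ).comp (ContinuousLinearMap.id ℝ F - fderiv ℝ (prox D p t) x)) x :=
    (innerSL ℝ).hasFDerivAt.comp x ((hasFDerivAt_id x).sub hx.hasFDerivAt)
  have h3 := second_derivative_symmetric h1 h2 v w
  simp only [ContinuousLinearMap.comp_apply, sub_apply,
    ContinuousLinearMap.id_apply, innerSL_apply_apply, inner_sub_left] at h3
  rw [real_inner_comm v w, real_inner_comm v] at h3
  linarith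

/-- Firm nonexpansiveness makes the difference quotients nonnegative for both signs of `s`. -/
theorem ClosedProperConvex.fderiv_prox_nonneg (hp : ClosedProperConvex D p) (ht : 0 < t)
    {x : F} (hx : DifferentiableAt ℝ (prox D p t) x) (v : F) :
    0 ≤ inner ℝ v (fderiv ℝ (prox D p t) x v) := by
  have h1 : Tendsto (fun s : ℝ => inner ℝ v (s⁻¹ • (prox D p t (x + s • v) - prox D p t x)))
      (𝓝[≠] 0) (𝓝 (inner ℝ v (fderiv ℝ (prox D p t) x v))) :=
    tendsto_const_nhds.inner (hx.hasFDerivAt.hasLineDerivAt v).tendsto_slope_zero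
  refine ge_of_tendsto h1 (eventually_mem_nhdsWithin.mono fun s hs => ?_)
  have hs' : s ≠ 0 := hs
  have h2 := hp.prox_firmlyNonexpansive ht (x + s • v) x
  rw [add_sub_cancel_left, inner_smul_right, real_inner_comm] at h2
  rw [inner_smul_right]
  have h3 : 0 ≤ s * inner ℝ v (prox D p t (x + s • v) - prox D p t x) :=
    le_trans (by positivity) h2
  have h4 : s⁻¹ * inner ℝ v (prox D p t (x + s • v) - prox D p t x)
      = (s⁻¹) ^ 2 * (s * inner ℝ v (prox D p t (x + s • v) - prox D p t x)) := by
    field_simp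
  rw [h4]; positivity

/-- Nonexpansiveness gives operator norm at most 1; where `prox` is not differentiable, `fderiv` is
0 and the bound still holds. -/
theorem ClosedProperConvex.fderiv_prox_le (hp : ClosedProperConvex D p) (ht : 0 < t)
    {x : F} (v : F) : inner ℝ v (fderiv ℝ (prox D p t) x v) ≤ ‖v‖ ^ 2 := by
  have h1 : ‖fderiv ℝ (prox D p t) x‖ ≤ 1 := by
    have : LipschitzWith 1 (prox D p t) := LipschitzWith.of_dist_le_mul fun y z => by
      simpa [dist_eq_norm] using hp.norm_prox_sub_le ht y z
    simpa using norm_fderiv_le_of_lipschitz ℝ this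
  have h2 := real_inner_le_norm v (fderiv ℝ (prox D p t) x v)
  have h3 := (fderiv ℝ (prox D p t) x).le_of_opNorm_le h1 v
  have := norm_nonneg v
  nlinarith

/-- Elements of the Clarke Jacobian of a proximal mapping are symmetric with spectrum
in `[0, 1]`. -/
theorem ClosedProperConvex.clarkeJacobian_prox (hp : ClosedProperConvex D p) (ht : 0 < t)
    {x : F} {P : F →L[ℝ] F} (hP : P ∈ clarkeJacobian (prox D p t) x) :
    (∀ v w, inner ℝ (P v) w = inner ℝ v (P w)) ∧
      ∀ v, 0 ≤ inner ℝ v (P v) ∧ inner ℝ v (P v) ≤ ‖v‖ ^ 2 := by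
  -- The conditions survive limits and cut out a convex set, so they pass from derivatives to the
  -- hull.
  refine convexHull_min (s := bSubdifferential (prox D p t) x) (t := {P : F →L[ℝ] F |
    (∀ v w, inner ℝ (P v) w = inner ℝ v (P w)) ∧
      ∀ v, 0 ≤ inner ℝ v (P v) ∧ inner ℝ v (P v) ≤ ‖v‖ ^ 2}) ?_ ?_ hP
  · rintro V ⟨u, -, hdiff, hV⟩
    have happ : ∀ v, Tendsto (fun k => fderiv ℝ (prox D p t) (u k) v) atTop (𝓝 (V v)) :=
      fun v => ((ContinuousLinearMap.apply ℝ F v).continuous.tendsto V).comp hV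
    refine ⟨fun v w => ?_, fun v => ⟨?_, ?_⟩⟩
    · refine tendsto_nhds_unique ((happ v).inner tendsto_const_nhds)
        (((tendsto_const_nhds (x := v)).inner (happ w)).congr fun k => ?_)
      exact (hp.fderiv_prox_symm ht (hdiff k) v w).symm
    · exact ge_of_tendsto' ((tendsto_const_nhds (x := v)).inner (happ v))
        fun k => hp.fderiv_prox_nonneg ht (hdiff k) v
    · exact le_of_tendsto' ((tendsto_const_nhds (x := v)).inner (happ v))
        fun k => hp.fderiv_prox_le ht v
  · rintro P ⟨hP1, hP2⟩ Q ⟨hQ1, hQ2⟩ a b ha hb hab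
    refine ⟨fun v w => ?_, fun v => ?_⟩
    · simp [inner_add_left, inner_add_right, inner_smul_left, inner_smul_right, hP1, hQ1]
    · simp only [add_apply, smul_apply, inner_add_right,
        inner_smul_right]
      have h1 := mul_le_mul_of_nonneg_left (hP2 v).2 ha
      have h2 := mul_le_mul_of_nonneg_left (hQ2 v).2 hb
      have h3 := mul_nonneg ha (hP2 v).1
      have h4 := mul_nonneg hb (hQ2 v).1
      have h5 : a * ‖v‖ ^ 2 + b * ‖v‖ ^ 2 = ‖v‖ ^ 2 := by rw [← add_mul, hab, one_mul]
      constructor <;> linarith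

end Clarke

/-! ### Conjugate gradients -/

section ConjugateGradient

variable {E : Type*} [NormedAddCommGroup E] [InnerProductSpace ℝ E]

/-- The sequence of CG states for `V d = b`. -/
noncomputable def cgState (V : E →L[ℝ] E) (b : E) (k : ℕ) : CGState E :=
  (cgStep V)^[k] { iter := 0, res := b, dir := b }

/-- The CG step length. -/
noncomputable def cgAlpha (V : E →L[ℝ] E) (b : E) (k : ℕ) : ℝ :=
  ‖(cgState V b k).res‖ ^ 2 / inner ℝ (cgState V b k).dir (V (cgState V b k).dir)

variable {V : E →L[ℝ] E} {b : E}

local notation "ρ" k:max => CGState.res (cgState V b k)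
local notation "π" k:max => CGState.dir (cgState V b k)

theorem cgState_res_succ (k : ℕ) : ρ (k + 1) = ρ k - cgAlpha V b k • V (π k) := by
  simp only [cgState, Function.iterate_succ_apply']; rfl

theorem cgState_dir_succ (k : ℕ) :
    π (k + 1) = ρ (k + 1) + (‖ρ (k + 1)‖ ^ 2 / ‖ρ k‖ ^ 2) • π k := by
  simp only [cgState, Function.iterate_succ_apply']; rfl

theorem cgIterate_succ (k : ℕ) :
    cgIterate V b (k + 1) = cgIterate V b k + cgAlpha V b k • π k := by
  simp only [cgIterate, cgState, Function.iterate_succ_apply']; rfl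

theorem cgState_dir_eq_zero_of_res {k : ℕ} (h : ρ k = 0) : π k = 0 := by
  cases k with
  | zero => exact h
  | succ k => rw [cgState_dir_succ, h]; simp

/-- Covers iterations past termination, where the step length may be `0 / 0 = 0`. -/
theorem cgState_dir_eq_zero_of_alpha (hV : ∀ d, ‖d‖ ^ 2 ≤ inner ℝ d (V d)) {k : ℕ}
    (h : cgAlpha V b k = 0) : π k = 0 := by
  rcases div_eq_zero_iff.1 h with h | h
  · exact cgState_dir_eq_zero_of_res (by simpa using h)
  · have := hV (π k)
    rw [h] at this
    simpa using le_antisymm this (by positivity)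

/-- The orthogonality and conjugacy relations of the CG method. -/
theorem cg_orthogonality (hsymm : ∀ v w, inner ℝ (V v) w = inner ℝ v (V w))
    (hV : ∀ d, ‖d‖ ^ 2 ≤ inner ℝ d (V d)) (k : ℕ) :
    inner ℝ (ρ k) (π k) = ‖ρ k‖ ^ 2 ∧
      ∀ i < k, inner ℝ (π i) (ρ k) = 0 ∧ inner ℝ (ρ i) (ρ k) = 0 ∧
        inner ℝ (π i) (V (π k)) = 0 := by
  induction k with
  | zero => exact ⟨real_inner_self_eq_norm_sq _, by simp⟩
  | succ k ih =>
    obtain ⟨ihC, ih⟩ := ih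
    have hα : cgAlpha V b k * inner ℝ (π k) (V (π k)) = ‖ρ k‖ ^ 2 := by
      by_cases h : inner ℝ (π k) (V (π k)) = 0
      · have h1 := hV (π k)
        have h2 : π k = 0 := by rw [h] at h1; simpa using le_antisymm h1 (by positivity)
        rw [h, mul_zero, ← ihC, h2, inner_zero_right]
      · exact div_mul_cancel₀ _ h
    have hD : ∀ i < k + 1, inner ℝ (π i) (ρ (k + 1)) = 0 := by
      intro i hi
      rw [cgState_res_succ, inner_sub_right, inner_smul_right]
      rcases Nat.lt_succ_iff_lt_or_eq.1 hi with h | rfl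
      · rw [(ih i h).1, (ih i h).2.2]; simp
      · rw [hα, real_inner_comm, ihC, sub_self]
    have hA : ∀ i < k + 1, inner ℝ (ρ i) (ρ (k + 1)) = 0 := by
      intro i hi
      cases i with
      | zero => exact hD 0 hi
      | succ i =>
        have h1 : ρ (i + 1) = π (i + 1) - (‖ρ (i + 1)‖ ^ 2 / ‖ρ i‖ ^ 2) • π i := by
          rw [cgState_dir_succ, add_sub_cancel_right]
        rw [h1, inner_sub_left, inner_smul_left, hD _ hi, hD i (by omega)]; simp
    refine ⟨?_, fun i hi => ⟨hD i hi, hA i hi, ?_⟩⟩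
    · rw [cgState_dir_succ, inner_add_right, inner_smul_right,
        real_inner_comm (π k), hD k (by omega), real_inner_self_eq_norm_sq]
      simp
    -- When `α_i ≠ 0`, `V π_i` is a multiple of `ρ_i - ρ_{i+1}`, so conjugacy follows from residual
    -- orthogonality; for `i = k` the coefficient in the new direction cancels the surviving term.
    · by_cases hαi : cgAlpha V b i = 0
      · rw [cgState_dir_eq_zero_of_alpha hV hαi, inner_zero_left]
      · have h1 : cgAlpha V b i • V (π i) = ρ i - ρ (i + 1) := by rw [cgState_res_succ]; abel
        have h2 : cgAlpha V b i * inner ℝ (V (π i)) (ρ (k + 1)) =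
            inner ℝ (ρ i) (ρ (k + 1)) - inner ℝ (ρ (i + 1)) (ρ (k + 1)) := by
          rw [← inner_sub_left, ← h1, real_inner_smul_left]
        rw [hA i hi, zero_sub] at h2
        refine (mul_eq_zero.1 (?_ : cgAlpha V b i * _ = 0)).resolve_left hαi
        rw [cgState_dir_succ, map_add, map_smul, inner_add_right, inner_smul_right, ← hsymm,
          mul_add, h2]
        rcases Nat.lt_succ_iff_lt_or_eq.1 hi with h | rfl
        · rw [hA (i + 1) (by omega), (ih i h).2.2]; simp
        · rw [mul_left_comm, hα, real_inner_self_eq_norm_sq, div_mul_cancel₀, neg_add_cancel]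
          intro h
          refine hαi ?_
          rw [cgAlpha, h, zero_div]

/-- CG iterates after the first step satisfy `⟨b, d⟩ ≥ ‖b‖² / L`, where `L` bounds `V`. -/
theorem norm_sq_le_inner_cgIterate (hsymm : ∀ v w, inner ℝ (V v) w = inner ℝ v (V w))
    (hV : ∀ d, ‖d‖ ^ 2 ≤ inner ℝ d (V d)) {L : ℝ} (hL : 0 < L)
    (hVL : ∀ d, inner ℝ d (V d) ≤ L * ‖d‖ ^ 2) (k : ℕ) :
    ‖b‖ ^ 2 / L ≤ inner ℝ b (cgIterate V b (k + 1)) := by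
  have hαnn : ∀ k, 0 ≤ cgAlpha V b k := fun k =>
    div_nonneg (by positivity) ((sq_nonneg _).trans (hV _))
  -- Since `b = ρ_0` is orthogonal to later residuals, `⟨b, π_{k+1}⟩` is a nonnegative multiple of
  -- `⟨b, π_k⟩`. Thus `⟨b, d⟩` never decreases and the first step gives the bound.
  have hdir : ∀ k, 0 ≤ inner ℝ b (π k) := by
    intro k
    induction k with
    | zero => exact real_inner_self_nonneg
    | succ k ih =>
      have h1 : inner ℝ b (ρ (k + 1)) = 0 :=
        ((cg_orthogonality hsymm hV (k + 1)).2 0 (Nat.succ_pos k)).2.1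
      rw [cgState_dir_succ, inner_add_right, inner_smul_right, h1, zero_add]
      positivity
  induction k with
  | zero =>
    rw [cgIterate_succ]
    have h0 : cgIterate V b 0 = 0 := rfl
    have h1 : cgAlpha V b 0 = ‖b‖ ^ 2 / inner ℝ b (V b) := rfl
    have h2 : π 0 = b := rfl
    rw [h0, zero_add, inner_smul_right, h1, h2, real_inner_self_eq_norm_sq]
    by_cases hb : b = 0
    · simp [hb]
    · have hb2 : 0 < ‖b‖ ^ 2 := by positivity
      have h3 := hb2.trans_le (hV b)
      rw [div_mul_eq_mul_div, div_le_div_iff₀ hL h3]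
      have := mul_le_mul_of_nonneg_left (hVL b) hb2.le
      linarith
  | succ k ih =>
    rw [cgIterate_succ, inner_add_right, inner_smul_right]
    have := mul_nonneg (hαnn (k + 1)) (hdir (k + 1))
    linarith

end ConjugateGradient

/-! ### Uniformity of directional derivatives -/

section BDifferentiability

variable {E F : Type*} [NormedAddCommGroup E] [NormedSpace ℝ E] [FiniteDimensional ℝ E]
  [NormedAddCommGroup F] [NormedSpace ℝ F]

/-- For Lipschitz maps on finite-dimensional spaces, directional derivatives approximate the
map uniformly over all directions. -/
theorem DirectionallyDifferentiableAt.exists_uniform_approx {G : E → F} {x : E} {L : ℝ}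
    (hL : 0 ≤ L) (hG : ∀ y z, ‖G y - G z‖ ≤ L * ‖y - z‖)
    (hx : DirectionallyDifferentiableAt G x) :
    ∃ G' : E → F, (∀ t : ℝ, 0 < t → ∀ h, G' (t • h) = t • G' h) ∧
      ∀ ε > 0, ∃ r > 0, ∀ h, ‖h‖ < r → ‖G (x + h) - G x - G' h‖ ≤ ε * ‖h‖ := by
  choose G' hG' using hx
  have hhom : ∀ t : ℝ, 0 < t → ∀ h, G' (t • h) = t • G' h := by
    intro t ht h
    have h1 : Tendsto (fun s : ℝ => s * t) (𝓝[>] 0) (𝓝[>] 0) := by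
      refine tendsto_nhdsWithin_iff.2 ⟨?_, eventually_mem_nhdsWithin.mono fun s hs =>
        mul_pos hs ht⟩
      have : Tendsto (fun s : ℝ => s * t) (𝓝 0) (𝓝 (0 * t)) := tendsto_id.mul_const t
      rw [zero_mul] at this
      exact this.mono_left nhdsWithin_le_nhds
    refine tendsto_nhds_unique (hG' (t • h)) ((((hG' h).comp h1).const_smul t).congr' ?_)
    refine eventually_mem_nhdsWithin.mono fun s hs => ?_
    simp only [Function.comp_apply, smul_smul, mul_inv]
    rw [mul_comm s⁻¹, ← mul_assoc, mul_inv_cancel₀ ht.ne', one_mul]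
  have hlip : ∀ h k, ‖G' h - G' k‖ ≤ L * ‖h - k‖ := by
    intro h k
    refine le_of_tendsto ((hG' h).sub (hG' k)).norm
      (eventually_mem_nhdsWithin.mono fun s hs => ?_)
    have hs' : 0 < s := hs
    rw [← smul_sub, norm_smul, Real.norm_eq_abs, abs_of_pos (inv_pos.2 hs'),
      inv_mul_le_iff₀ hs', sub_sub_sub_cancel_right]
    refine (hG _ _).trans_eq ?_
    rw [add_sub_add_left_eq_sub, ← smul_sub, norm_smul, Real.norm_eq_abs, abs_of_pos hs']
    ring
  refine ⟨G', hhom, fun ε hε => ?_⟩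
  -- A finite `e`-net of the unit sphere suffices: moving to a net point costs `L * e` for `G`, `L *
  -- e` for `G'`, and the approximation there costs `e`.
  set e := ε / (2 * L + 1) with he
  have he0 : 0 < e := by positivity
  have heε : (2 * L + 1) * e = ε := mul_div_cancel₀ _ (by positivity)
  obtain ⟨T, hTS, hT, hcov⟩ := (isCompact_sphere (0 : E) 1).finite_cover_balls he0
  have hev : ∀ᶠ s in 𝓝[>] (0 : ℝ), ∀ c ∈ T, ‖s⁻¹ • (G (x + s • c) - G x) - G' c‖ ≤ e := by
    refine (hT.eventually_all).2 fun c _ => ?_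
    have := (tendsto_iff_norm_sub_tendsto_zero.1 (hG' c)).eventually (gt_mem_nhds he0)
    exact this.mono fun s hs => hs.le
  obtain ⟨r, hr, hrs⟩ := mem_nhdsGT_iff_exists_Ioo_subset.1 hev
  refine ⟨r, hr, fun h hh => ?_⟩
  by_cases h0 : h = 0
  · have h1 : G' 0 = 0 := by
      have h2 := hhom 2 two_pos 0
      rw [smul_zero, two_smul] at h2
      exact left_eq_add.1 h2
    simp [h0, h1]
  have hs : 0 < ‖h‖ := norm_pos_iff.2 h0
  set u := ‖h‖⁻¹ • h with hu
  have hhu : h = ‖h‖ • u := by rw [hu, smul_smul, mul_inv_cancel₀ hs.ne', one_smul]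
  have huS : u ∈ Metric.sphere (0 : E) 1 := by
    rw [mem_sphere_zero_iff_norm, hu, norm_smul, norm_inv, norm_norm, inv_mul_cancel₀ hs.ne']
  obtain ⟨c, hc, huc⟩ := Set.mem_iUnion₂.1 (hcov huS)
  rw [Metric.mem_ball, dist_eq_norm] at huc
  have h1 : ‖G (x + ‖h‖ • c) - G x - ‖h‖ • G' c‖ ≤ e * ‖h‖ := by
    have h2 : ‖‖h‖⁻¹ • (G (x + ‖h‖ • c) - G x) - G' c‖ ≤ e := hrs ⟨hs, hh⟩ c hc
    have h3 : G (x + ‖h‖ • c) - G x - ‖h‖ • G' c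
        = ‖h‖ • (‖h‖⁻¹ • (G (x + ‖h‖ • c) - G x) - G' c) := by
      rw [smul_sub, smul_smul, mul_inv_cancel₀ hs.ne', one_smul]
    rw [h3, norm_smul, norm_norm, mul_comm]
    gcongr
  have h2 : ‖G (x + h) - G (x + ‖h‖ • c)‖ ≤ L * e * ‖h‖ := by
    refine (hG _ _).trans ?_
    nth_rewrite 1 [hhu]
    rw [add_sub_add_left_eq_sub, ← smul_sub, norm_smul, norm_norm, mul_assoc, mul_comm ‖h‖]
    gcongr
  have h3 : ‖‖h‖ • G' c - G' h‖ ≤ L * e * ‖h‖ := by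
    nth_rewrite 2 [hhu]
    rw [hhom _ hs, ← smul_sub, norm_smul, norm_norm, mul_comm]
    gcongr
    refine (hlip _ _).trans ?_
    rw [norm_sub_rev]
    gcongr
  calc ‖G (x + h) - G x - G' h‖
      = ‖(G (x + h) - G (x + ‖h‖ • c)) + (G (x + ‖h‖ • c) - G x - ‖h‖ • G' c)
          + (‖h‖ • G' c - G' h)‖ := by congr 1; abel
    _ ≤ L * e * ‖h‖ + e * ‖h‖ + L * e * ‖h‖ := norm_add₃_le.trans (by linarith)
    _ = ε * ‖h‖ := by rw [← heε]; ring

end BDifferentiability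

/-! ### Strongly convex functions and global convergence -/

section Newton

variable {E : Type*} [NormedAddCommGroup E] [InnerProductSpace ℝ E]

/-- `f` is strongly convex (with modulus `1`) and `L`-smooth, with gradient `g`. -/
structure SmoothStrongConvex (f : E → ℝ) (g : E → E) (L : ℝ) : Prop where
  one_le : 1 ≤ L
  lower : ∀ X Y, f X + inner ℝ (g X) (Y - X) + 1 / 2 * ‖Y - X‖ ^ 2 ≤ f Y
  upper : ∀ X Y, f Y ≤ f X + inner ℝ (g X) (Y - X) + L / 2 * ‖Y - X‖ ^ 2
  lipschitz : ∀ X Y, ‖g X - g Y‖ ≤ L * ‖X - Y‖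

/-- `V` is symmetric with `I ≤ V ≤ L I`. -/
structure SymmetricBetween (V : E →L[ℝ] E) (L : ℝ) : Prop where
  symm : ∀ v w, inner ℝ (V v) w = inner ℝ v (V w)
  lower : ∀ d, ‖d‖ ^ 2 ≤ inner ℝ d (V d)
  upper : ∀ d, inner ℝ d (V d) ≤ L * ‖d‖ ^ 2

theorem SymmetricBetween.norm_le {V : E →L[ℝ] E} {L : ℝ} (h : SymmetricBetween V L) (d : E) :
    ‖d‖ ≤ ‖V d‖ := by
  have h1 := h.lower d
  have h2 := real_inner_le_norm d (V d)
  by_contra hcon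
  push Not at hcon
  have := norm_nonneg (V d)
  nlinarith

namespace SmoothStrongConvex

variable {f : E → ℝ} {g : E → E} {L : ℝ}

theorem hasGradientAt [CompleteSpace E] (hf : SmoothStrongConvex f g L) (X : E) :
    HasGradientAt f (g X) X := by
  refine hasGradientAt_of_quadratic_bound (C := L / 2) fun Y => ?_
  have h1 := hf.lower X Y
  have h2 := hf.upper X Y
  have h3 : 0 ≤ ‖Y - X‖ ^ 2 := by positivity
  have h4 : 0 ≤ L / 2 * ‖Y - X‖ ^ 2 := mul_nonneg (by linarith [hf.one_le]) h3
  rw [abs_le]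
  constructor <;> linarith

theorem strong_monotone (hf : SmoothStrongConvex f g L) (X Y : E) :
    ‖X - Y‖ ^ 2 ≤ inner ℝ (g X - g Y) (X - Y) := by
  have h1 := hf.lower X Y
  have h2 := hf.lower Y X
  rw [← neg_sub X Y, inner_neg_right, norm_neg] at h1
  rw [inner_sub_left]
  linarith

theorem norm_sub_le (hf : SmoothStrongConvex f g L) (X Y : E) : ‖X - Y‖ ≤ ‖g X - g Y‖ := by
  have h1 := hf.strong_monotone X Y
  have h2 := real_inner_le_norm (g X - g Y) (X - Y)
  by_contra hcon
  push Not at hcon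
  have := norm_nonneg (g X - g Y)
  nlinarith

/-- The gradient has a zero: a gradient step of length `L⁻²` is a contraction. -/
theorem exists_zero [CompleteSpace E] (hf : SmoothStrongConvex f g L) : ∃ X, g X = 0 := by
  have hL := hf.one_le
  -- The squared contraction factor is `1 - 2a + a²L² = 1 - a`.
  set a := (L ^ 2)⁻¹ with ha
  have haL : a * L ^ 2 = 1 := inv_mul_cancel₀ (by positivity)
  have ha0 : 0 < a := by positivity
  have ha1 : a ≤ 1 := inv_le_one_of_one_le₀ (one_le_pow₀ hL)
  have hK : (1 - a).sqrt.toNNReal < 1 :=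
    Real.toNNReal_lt_one.2 ((Real.sqrt_lt' one_pos).2 (by linarith))
  have hc : ContractingWith (1 - a).sqrt.toNNReal (fun X => X - a • g X) := by
    refine ⟨hK, LipschitzWith.of_dist_le_mul fun X Y => ?_⟩
    rw [dist_eq_norm, dist_eq_norm, Real.coe_toNNReal _ (Real.sqrt_nonneg _)]
    refine abs_le_of_sq_le_sq' ?_ (by positivity) |>.2
    have h1 : X - a • g X - (Y - a • g Y) = (X - Y) - a • (g X - g Y) := by module
    rw [h1, norm_sub_sq_real, inner_smul_right, norm_smul, mul_pow, mul_pow,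
      Real.sq_sqrt (by linarith), Real.norm_eq_abs, sq_abs, real_inner_comm]
    have h2 := mul_le_mul_of_nonneg_left (hf.strong_monotone X Y) ha0.le
    have h3 : a ^ 2 * ‖g X - g Y‖ ^ 2 ≤ a ^ 2 * (L * ‖X - Y‖) ^ 2 := by
      gcongr; exact hf.lipschitz X Y
    have h4 : a ^ 2 * (L * ‖X - Y‖) ^ 2 = a * ‖X - Y‖ ^ 2 := by
      linear_combination a * ‖X - Y‖ ^ 2 * haL
    linarith
  have h := hc.fixedPoint_isFixedPt
  refine ⟨ContractingWith.fixedPoint _ hc, ?_⟩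
  have h1 : a • g (ContractingWith.fixedPoint _ hc) = 0 := by
    simpa [Function.IsFixedPt] using h
  exact (smul_eq_zero.1 h1).resolve_left ha0.ne'

section Descent

variable [CompleteSpace E] {H : E → Set (E →L[ℝ] E)} {μ τ η δ : ℝ}

/-- Sufficient decrease in one step of the method. -/
theorem step_decrease (hf : SmoothStrongConvex f g L)
    (hH : ∀ X, ∀ V ∈ H X, SymmetricBetween V L) (hμ : μ ∈ Set.Ioo (0 : ℝ) 1)
    (hτ : 0 < τ) (hη : η < 1) (hδ : δ ∈ Set.Ioo (0 : ℝ) 1) {X X' : E}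
    (h : SSNCGStep f H μ τ η δ X X') :
    μ / L * min 1 (δ * (1 - μ) / (2 * L ^ 2)) * ‖g X‖ ^ 2 ≤ f X - f X' := by
  have hL := hf.one_le
  have hL0 : 0 < L := by linarith
  unfold SSNCGStep at h
  rw [(hf.hasGradientAt X).gradient] at h
  rcases h with ⟨h0, rfl⟩ | ⟨hg, V, hV, d, ⟨k, hk⟩, hres, m, hm, rfl⟩
  · simp [h0]
  have hVs := hH X V hV
  have hg0 : 0 < ‖g X‖ := norm_pos_iff.2 hg
  have hmem := hm.1
  rw [Set.mem_ofPred_eq] at hmem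
  -- The CG iterate of index 0 is `d = 0`, which the strict line search inequality rules out.
  have hdesc : ‖g X‖ ^ 2 / L ≤ -inner ℝ (g X) d := by
    cases k with
    | zero =>
      have hd : d = 0 := hk
      simp [hd] at hmem
    | succ k =>
      have := norm_sq_le_inner_cgIterate (b := -g X) hVs.symm hVs.lower hL0 hVs.upper k
      rwa [← hk, norm_neg, inner_neg_left] at this
  have hres' : ‖V d + g X‖ ≤ ‖g X‖ := by
    by_cases h1 : 1 ≤ ‖g X‖
    · exact (hres.trans (min_le_left _ _)).trans (hη.le.trans h1)
    · refine (hres.trans (min_le_right _ _)).trans ?_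
      exact (Real.rpow_le_rpow_of_exponent_ge hg0 (not_le.1 h1).le
        (by linarith : 1 ≤ 1 + τ)).trans_eq (Real.rpow_one _)
  have hdnorm : ‖d‖ ≤ 2 * ‖g X‖ := by
    have h1 := hVs.norm_le d
    have h2 : ‖V d‖ ≤ ‖V d + g X‖ + ‖g X‖ := by
      simpa using _root_.norm_sub_le (V d + g X) (g X)
    linarith
  have hstep : min 1 (δ * (1 - μ) / (2 * L ^ 2)) ≤ δ ^ m := by
    cases m with
    | zero => simp
    | succ m =>
      refine (min_le_right _ _).trans ?_
      -- The last rejected trial `δ ^ m` violates the test; with `L`-smoothness and `‖d‖ ≤ 2‖g X‖`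
      -- this forces `δ ^ m ≥ (1 - μ) / (2L²)`. The accepted step is one factor `δ` smaller.
      have hnot : ¬ (f (X + δ ^ m • d) < f X + μ * δ ^ m * inner ℝ (g X) d) := fun hlt => by
        have : m + 1 ≤ m := hm.2 hlt
        omega
      have h1 := hf.upper X (X + δ ^ m • d)
      rw [add_sub_cancel_left, inner_smul_right, norm_smul, mul_pow, Real.norm_eq_abs,
        sq_abs] at h1
      set t := δ ^ m with ht
      have ht0 : 0 < t := pow_pos hδ.1 m
      have h2 : t * ((1 - μ) * -inner ℝ (g X) d) ≤ t * (L / 2 * t * ‖d‖ ^ 2) := by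
        linarith
      have h3 := le_of_mul_le_mul_left h2 ht0
      have h4 : (1 - μ) * (‖g X‖ ^ 2 / L) ≤ L / 2 * t * (2 * ‖g X‖) ^ 2 :=
        (mul_le_mul_of_nonneg_left hdesc (by linarith [hμ.2])).trans
          (h3.trans (by gcongr))
      have h5 : (1 - μ) / (2 * L ^ 2) ≤ t := by
        rw [div_le_iff₀ (by positivity)]
        rw [← mul_div_assoc, div_le_iff₀ hL0] at h4
        refine le_of_mul_le_mul_right (h4.trans_eq ?_) (by positivity : 0 < ‖g X‖ ^ 2)
        ring
      rw [pow_succ, mul_div_assoc, mul_comm]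
      exact mul_le_mul_of_nonneg_right h5 hδ.1.le
  have h6 : min 1 (δ * (1 - μ) / (2 * L ^ 2)) * (‖g X‖ ^ 2 / L)
      ≤ δ ^ m * -inner ℝ (g X) d :=
    mul_le_mul hstep hdesc (by positivity) (pow_pos hδ.1 m).le
  have h7 := mul_le_mul_of_nonneg_left h6 hμ.1.le
  have h8 : μ * (min 1 (δ * (1 - μ) / (2 * L ^ 2)) * (‖g X‖ ^ 2 / L))
      = μ / L * min 1 (δ * (1 - μ) / (2 * L ^ 2)) * ‖g X‖ ^ 2 := by ring
  linarith

/-- Global convergence of the method. -/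
theorem tendsto_zero (hf : SmoothStrongConvex f g L)
    (hH : ∀ X, ∀ V ∈ H X, SymmetricBetween V L) (hμ : μ ∈ Set.Ioo (0 : ℝ) 1)
    (hτ : 0 < τ) (hη : η < 1) (hδ : δ ∈ Set.Ioo (0 : ℝ) 1) {X : ℕ → E}
    (hX : ∀ j, SSNCGStep f H μ τ η δ (X j) (X (j + 1))) {Xbar : E} (hXbar : g Xbar = 0) :
    Tendsto X atTop (𝓝 Xbar) := by
  have hL := hf.one_le
  set c := μ / L * min 1 (δ * (1 - μ) / (2 * L ^ 2)) with hc
  have hc0 : 0 < c := by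
    have h1 : 0 < 1 - μ := by linarith [hμ.2]
    have h2 := hμ.1
    have h3 := hδ.1
    positivity
  have hdec : ∀ j, c * ‖g (X j)‖ ^ 2 ≤ f (X j) - f (X (j + 1)) := fun j =>
    hf.step_decrease hH hμ hτ hη hδ (hX j)
  have hanti : Antitone fun j => f (X j) := antitone_nat_of_succ_le fun j => by
    have := hdec j
    have : 0 ≤ c * ‖g (X j)‖ ^ 2 := by positivity
    linarith
  have hbdd : BddBelow (Set.range fun j => f (X j)) := by
    refine ⟨f Xbar, ?_⟩
    rintro _ ⟨j, rfl⟩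
    have h1 := hf.lower Xbar (X j)
    rw [hXbar, inner_zero_left] at h1
    have : 0 ≤ 1 / 2 * ‖X j - Xbar‖ ^ 2 := by positivity
    simp only; linarith
  have hlim := tendsto_atTop_ciInf hanti hbdd
  have hdiff : Tendsto (fun j => c⁻¹ * (f (X j) - f (X (j + 1)))) atTop (𝓝 0) := by
    have := (hlim.sub (hlim.comp (tendsto_add_atTop_nat 1))).const_mul c⁻¹
    simpa using this
  have hsq : Tendsto (fun j => ‖X j - Xbar‖ ^ 2) atTop (𝓝 0) := by
    refine squeeze_zero (fun j => by positivity) (fun j => ?_) hdiff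
    rw [le_inv_mul_iff₀ hc0]
    refine le_trans ?_ (hdec j)
    have h1 := hf.norm_sub_le (X j) Xbar
    rw [hXbar, sub_zero] at h1
    gcongr
  rw [tendsto_iff_norm_sub_tendsto_zero]
  have := (Real.continuous_sqrt.tendsto 0).comp hsq
  simpa [Function.comp_def, Real.sqrt_sq] using this

end Descent

/-! ### Local convergence order -/

section Rate

/-- Second-order expansion `f(X̄ + h) - f(X̄) = ½ ⟨g(X̄ + h), h⟩ + o(‖h‖²)` at a stationary point
where the gradient is directionally differentiable. -/
theorem half_inner_le [FiniteDimensional ℝ E] (hf : SmoothStrongConvex f g L) {Xbar : E}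
    (hXbar : g Xbar = 0) (hdir : DirectionallyDifferentiableAt g Xbar) {ε : ℝ} (hε : 0 < ε) :
    ∃ r > 0, ∀ h, ‖h‖ < r →
      1 / 2 * inner ℝ (g (Xbar + h)) h - ε * ‖h‖ ^ 2 ≤ f (Xbar + h) - f Xbar := by
  obtain ⟨g', hhom, happ⟩ :=
    hdir.exists_uniform_approx (by linarith [hf.one_le]) hf.lipschitz
  obtain ⟨r, hr, hrh⟩ := happ (ε / 2) (by positivity)
  refine ⟨r, hr, fun h hh => ?_⟩
  simp only [hXbar, sub_zero] at hrh
  -- By positive homogeneity of `g'`, subtracting this quadratic leaves a derivative of size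
  -- `(ε/2)‖h‖²` on `[0, 1]`. Replacing `g' h` by `g (Xbar + h)` costs another `(ε/4)‖h‖²`.
  set ψ : ℝ → ℝ := fun t => f (Xbar + t • h) - t ^ 2 / 2 * inner ℝ (g' h) h with hψ
  have hderiv : ∀ t ∈ Set.Icc (0 : ℝ) 1, HasDerivWithinAt ψ
      (inner ℝ (g (Xbar + t • h)) h - t * inner ℝ (g' h) h) (Set.Icc 0 1) t := by
    intro t _
    have h1 : HasDerivAt (fun s : ℝ => Xbar + s • h) h t := by
      simpa using ((hasDerivAt_id t).smul_const h).const_add Xbar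
    have h2 := ((hf.hasGradientAt (Xbar + t • h)).hasFDerivAt).comp_hasDerivAt t h1
    have h3 : HasDerivAt (fun s : ℝ => s ^ 2 / 2 * inner ℝ (g' h) h)
        (t * inner ℝ (g' h) h) t := by
      have := (((hasDerivAt_id t).pow 2).div_const 2).mul_const (inner ℝ (g' h) h)
      simpa using this
    have h4 := h2.sub h3
    simp only [InnerProductSpace.toDual_apply_apply] at h4
    exact h4.hasDerivWithinAt
  have hbound : ∀ t ∈ Set.Ico (0 : ℝ) 1,
      ‖inner ℝ (g (Xbar + t • h)) h - t * inner ℝ (g' h) h‖ ≤ ε / 2 * ‖h‖ ^ 2 := by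
    rintro t ⟨ht0, ht1⟩
    rcases ht0.eq_or_lt with rfl | ht
    · simp only [zero_smul, add_zero, hXbar, inner_zero_left, zero_mul, sub_zero, norm_zero]
      positivity
    · have hth : ‖t • h‖ ≤ ‖h‖ := by
        rw [norm_smul, Real.norm_eq_abs, abs_of_pos ht]
        exact mul_le_of_le_one_left (norm_nonneg h) ht1.le
      have h1 := hrh (t • h) (hth.trans_lt hh)
      rw [hhom t ht] at h1
      rw [← real_inner_smul_left, ← inner_sub_left]
      calc _ ≤ ‖g (Xbar + t • h) - t • g' h‖ * ‖h‖ := norm_inner_le_norm _ _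
        _ ≤ ε / 2 * ‖h‖ * ‖h‖ := by
          gcongr
          exact h1.trans (by gcongr)
        _ = _ := by ring
  have hmv := norm_image_sub_le_of_norm_deriv_le_segment_01' hderiv hbound
  have h2 : inner ℝ (g (Xbar + h) - g' h) h ≤ ε / 2 * ‖h‖ ^ 2 :=
    (real_inner_le_norm _ _).trans ((mul_le_mul_of_nonneg_right (hrh h hh)
      (norm_nonneg h)).trans_eq (by ring))
  rw [inner_sub_left] at h2
  simp only [hψ, one_smul, zero_smul, add_zero, Real.norm_eq_abs] at hmv
  have h3 := (abs_le.1 hmv).1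
  have h4 : 0 ≤ ε * ‖h‖ ^ 2 := by positivity
  linarith

variable [FiniteDimensional ℝ E] {H : E → Set (E →L[ℝ] E)} {μ τ η δ : ℝ}

/-- The local convergence order of the method. -/
theorem isBigO_rate (hf : SmoothStrongConvex f g L)
    (hH : ∀ X, ∀ V ∈ H X, SymmetricBetween V L) (hμ : μ ∈ Set.Ioo (0 : ℝ) (1 / 2))
    (hτ : τ ∈ Set.Ioc (0 : ℝ) 1) {X : ℕ → E}
    (hX : ∀ j, SSNCGStep f H μ τ η δ (X j) (X (j + 1))) {Xbar : E} (hXbar : g Xbar = 0)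
    (hlim : Tendsto X atTop (𝓝 Xbar)) (hdir : DirectionallyDifferentiableAt g Xbar)
    {C r : ℝ} (hr : 0 < r) (hC : ∀ Y, ‖Y - Xbar‖ < r → ∀ V ∈ H Y,
      ‖g Y - V (Y - Xbar)‖ ≤ C * ‖Y - Xbar‖ ^ 2) :
    (fun j => ‖X (j + 1) - Xbar‖) =O[atTop] (fun j => ‖X j - Xbar‖ ^ (1 + τ)) := by
  have hL := hf.one_le
  have hL0 : 0 < L := by linarith
  have hτ0 := hτ.1
  have hμ2 := hμ.2
  set M := L ^ (1 + τ) + |C| with hM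
  have hM0 : 0 < M := by positivity
  -- The errors in the unit-step test add up to at most `ε(1 + 2L)‖h‖²`, half of the available `(1/2
  -- - μ)‖h‖²`.
  set ε := (1 / 2 - μ) / (2 * (1 + 2 * L)) with hε
  have hε0 : 0 < ε := div_pos (by linarith) (by positivity)
  have hεL : ε * (2 * (1 + 2 * L)) = 1 / 2 - μ := div_mul_cancel₀ _ (by positivity)
  have hε1 : ε ≤ 1 := by nlinarith [hμ.1]
  obtain ⟨r', hr', hexp⟩ := hf.half_inner_le hXbar hdir hε0
  have hnorm : Tendsto (fun j => ‖X j - Xbar‖) atTop (𝓝 0) :=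
    tendsto_iff_norm_sub_tendsto_zero.1 hlim
  have hpow : Tendsto (fun j => M * ‖X j - Xbar‖ ^ τ) atTop (𝓝 0) := by
    have := (hnorm.rpow_const (Or.inr hτ0.le) (p := τ)).const_mul M
    simpa [Real.zero_rpow hτ0.ne'] using this
  refine IsBigO.of_bound M ?_
  filter_upwards [hnorm.eventually (gt_mem_nhds hr), hnorm.eventually (gt_mem_nhds hr'),
    hnorm.eventually (gt_mem_nhds one_pos), hpow.eventually (gt_mem_nhds hε0)]
    with j hj1 hj2 hj3 hj4
  rw [norm_norm, Real.norm_of_nonneg (by positivity)]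
  have hstep := hX j
  unfold SSNCGStep at hstep
  rw [(hf.hasGradientAt (X j)).gradient] at hstep
  rcases hstep with ⟨h0, hnext⟩ | ⟨hg, V, hV, d, -, hres, m, hm, hnext⟩
  · have h1 := hf.norm_sub_le (X j) Xbar
    rw [h0, hXbar, sub_zero, norm_zero] at h1
    rw [hnext]
    exact h1.trans (by positivity)
  set h := X j - Xbar with hh
  have hXh : X j = Xbar + h := by rw [hh]; abel
  have hgn : ‖g (X j)‖ ≤ L * ‖h‖ := by
    have := hf.lipschitz (X j) Xbar
    rwa [hXbar, sub_zero] at this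
  have hh0 : 0 < ‖h‖ := by
    have := norm_pos_iff.2 hg
    exact pos_of_mul_pos_right (this.trans_le hgn) hL0.le
  -- `V(h + d)` is the CG residual minus the semismooth remainder, and `V ≥ I` transfers the bound
  -- to `h + d`. The quadratic remainder is absorbed because `τ ≤ 1` and `‖h‖ < 1`.
  have herr : ‖h + d‖ ≤ M * ‖h‖ ^ (1 + τ) := by
    have h1 := (hH _ V hV).norm_le (h + d)
    have h2 : V (h + d) = (V d + g (X j)) - (g (X j) - V h) := by rw [map_add]; abel
    have h3 : ‖V d + g (X j)‖ ≤ L ^ (1 + τ) * ‖h‖ ^ (1 + τ) := by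
      rw [← Real.mul_rpow hL0.le hh0.le]
      exact (hres.trans (min_le_right _ _)).trans
        (Real.rpow_le_rpow (norm_nonneg _) hgn (by linarith))
    have h4 : ‖g (X j) - V h‖ ≤ |C| * ‖h‖ ^ (1 + τ) := by
      refine (hC (X j) hj1 V hV).trans ?_
      have h5 : ‖h‖ ^ 2 ≤ ‖h‖ ^ (1 + τ) := by
        rw [← Real.rpow_two]
        exact Real.rpow_le_rpow_of_exponent_ge hh0 hj3.le (by linarith [hτ.2])
      exact mul_le_mul (le_abs_self C) h5 (by positivity) (abs_nonneg C)
    rw [h2] at h1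
    have h6 := _root_.norm_sub_le (V d + g (X j)) (g (X j) - V h)
    rw [hM, add_mul]
    linarith
  have hsmall : ‖h + d‖ ≤ ε * ‖h‖ := by
    rw [add_comm 1 τ, Real.rpow_add_one hh0.ne', ← mul_assoc] at herr
    exact herr.trans (mul_le_mul_of_nonneg_right hj4.le hh0.le)
  -- Since `d ≈ -h`, the test reduces to `(1/2 - μ)⟨g, h⟩` exceeding the errors, where `⟨g, h⟩ ≥
  -- ‖h‖²`.
  have hunit : f (X j + d) < f (X j) + μ * inner ℝ (g (X j)) d := by
    have h1 := hf.upper Xbar (X j + d)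
    have h2 : X j + d - Xbar = h + d := by rw [hh]; abel
    rw [hXbar, inner_zero_left, h2] at h1
    have h3 : L / 2 * ‖h + d‖ ^ 2 ≤ L / 2 * (ε * ‖h‖) ^ 2 := by gcongr
    have h4 := hexp h hj2
    rw [← hXh] at h4
    have h5 : inner ℝ (g (X j)) d = inner ℝ (g (X j)) (h + d) - inner ℝ (g (X j)) h := by
      rw [inner_add_right]; ring
    have h6 : -(L * ‖h‖ * (ε * ‖h‖)) ≤ inner ℝ (g (X j)) (h + d) := by
      refine (abs_le.1 ((abs_real_inner_le_norm _ _).trans ?_)).1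
      exact mul_le_mul hgn hsmall (norm_nonneg _) (by positivity)
    have h7 := hf.strong_monotone (X j) Xbar
    rw [hXbar, sub_zero] at h7
    have h8 := mul_le_mul_of_nonneg_left h7 (by linarith : 0 ≤ 1 / 2 - μ)
    have h9 := mul_le_mul_of_nonneg_left h6 hμ.1.le
    have hsq : 0 < ‖h‖ ^ 2 := by positivity
    have h10 : L / 2 * (ε * ‖h‖) ^ 2 ≤ L * ε * ‖h‖ ^ 2 := by
      have : ε * ε ≤ 1 * ε := mul_le_mul_of_nonneg_right hε1 hε0.le
      have := mul_le_mul_of_nonneg_left this (by positivity : 0 ≤ L / 2 * ‖h‖ ^ 2)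
      have : 0 ≤ L * ε * ‖h‖ ^ 2 := by positivity
      linarith
    have h11 : μ * (L * ‖h‖ * (ε * ‖h‖)) ≤ L * ε * ‖h‖ ^ 2 := by
      have : 0 ≤ L * ε * ‖h‖ ^ 2 := by positivity
      have := mul_le_mul_of_nonneg_right (by linarith : μ ≤ 1) this
      linarith
    have h12 : ε * (1 + 2 * L) * ‖h‖ ^ 2 < (1 / 2 - μ) * ‖h‖ ^ 2 := by
      refine mul_lt_mul_of_pos_right ?_ hsq
      linarith
    rw [h5]
    linarith
  have hm0 : m = 0 := by
    refine Nat.le_zero.1 (hm.2 ?_)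
    simpa using hunit
  have h13 : X (j + 1) - Xbar = h + d := by
    rw [hnext, hm0, pow_zero, one_smul, hh]; abel
  rw [h13]
  exact herr

end Rate

end SmoothStrongConvex

end Newton

/-! ### The function `φ` and its generalized Hessians -/

section AugmentedLagrangian

variable {E F : Type*} [NormedAddCommGroup E] [InnerProductSpace ℝ E]
  [NormedAddCommGroup F] [InnerProductSpace ℝ F]
  {A : E} {B : E →L[ℝ] F} {D : Set F} {p : F → ℝ} {σ : ℝ} {Z : F}

theorem augLagrangian_eq (hσ : 0 < σ) (X : E) (U : F) :
    augLagrangian A B p σ Z X U = 1 / 2 * ‖X - A‖ ^ 2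
      + σ * (σ⁻¹ * p U + 1 / 2 * ‖U - (σ⁻¹ • Z + B X)‖ ^ 2) - ‖Z‖ ^ 2 / (2 * σ) := by
  have h1 : U - (σ⁻¹ • Z + B X) = -(σ⁻¹ • Z + (B X - U)) := by abel
  rw [h1, norm_neg, norm_add_sq_real, norm_smul, real_inner_smul_left, mul_pow,
    Real.norm_eq_abs, sq_abs, augLagrangian]
  field_simp
  ring

variable [FiniteDimensional ℝ F]

/-- `φ` in terms of the Moreau envelope of `p / σ`. -/
theorem phi_eq (hp : ClosedProperConvex D p) (hσ : 0 < σ) (X : E) :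
    phi A B D p σ Z X = 1 / 2 * ‖X - A‖ ^ 2 + σ * moreau D p σ⁻¹ (σ⁻¹ • Z + B X)
      - ‖Z‖ ^ 2 / (2 * σ) := by
  have hprox := hp.isProxPoint_prox (inv_pos.2 hσ) (σ⁻¹ • Z + B X)
  have hle : ∀ U : D, 1 / 2 * ‖X - A‖ ^ 2 + σ * moreau D p σ⁻¹ (σ⁻¹ • Z + B X)
      - ‖Z‖ ^ 2 / (2 * σ) ≤ augLagrangian A B p σ Z X U := by
    intro U
    rw [augLagrangian_eq hσ]
    have := mul_le_mul_of_nonneg_left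
      (hp.moreau_le (inv_pos.2 hσ) (σ⁻¹ • Z + B X) U.2) hσ.le
    linarith
  have : Nonempty D := ⟨⟨_, hprox.2⟩⟩
  refine le_antisymm ?_ (le_ciInf hle)
  refine (ciInf_le ⟨_, Set.forall_mem_range.2 hle⟩ ⟨_, hprox.2⟩).trans_eq ?_
  rw [augLagrangian_eq hσ]
  rfl

variable [CompleteSpace E]

/-- The gradient of `φ`. -/
noncomputable def phiGradient (A : E) (B : E →L[ℝ] F) (D : Set F) (p : F → ℝ) (σ : ℝ) (Z : F)
    (X : E) : E :=
  X - A + σ • ContinuousLinearMap.adjoint B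
    (σ⁻¹ • Z + B X - prox D p σ⁻¹ (σ⁻¹ • Z + B X))

/-- The term `½‖X - A‖²` supplies the modulus 1; the envelope is convex and 1-smooth, so composing
with `B` and scaling by `σ` adds `σ‖B‖²` to `L`. -/
theorem smoothStrongConvex_phi (hp : ClosedProperConvex D p) (hσ : 0 < σ) :
    SmoothStrongConvex (phi A B D p σ Z) (phiGradient A B D p σ Z) (1 + σ * ‖B‖ ^ 2) := by
  have hσ' := inv_pos.2 hσ
  have hinner : ∀ X Y, inner ℝ (phiGradient A B D p σ Z X) (Y - X) = inner ℝ (X - A) (Y - X)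
      + σ * inner ℝ (σ⁻¹ • Z + B X - prox D p σ⁻¹ (σ⁻¹ • Z + B X))
        (σ⁻¹ • Z + B Y - (σ⁻¹ • Z + B X)) := by
    intro X Y
    rw [phiGradient, inner_add_left, real_inner_smul_left,
      ContinuousLinearMap.adjoint_inner_left, map_sub, add_sub_add_left_eq_sub]
  have hquad : ∀ X Y : E, ‖Y - A‖ ^ 2
      = ‖X - A‖ ^ 2 + 2 * inner ℝ (X - A) (Y - X) + ‖Y - X‖ ^ 2 := by
    intro X Y
    rw [← norm_add_sq_real]
    congr 2
    abel
  refine ⟨le_add_of_nonneg_right (by positivity), fun X Y => ?_, fun X Y => ?_, fun X Y => ?_⟩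
  · rw [phi_eq hp hσ, phi_eq hp hσ, hinner, hquad X Y]
    have := mul_le_mul_of_nonneg_left
      (hp.moreau_lower hσ' (σ⁻¹ • Z + B X) (σ⁻¹ • Z + B Y)) hσ.le
    linarith
  · rw [phi_eq hp hσ, phi_eq hp hσ, hinner, hquad X Y]
    have h1 := mul_le_mul_of_nonneg_left
      (hp.moreau_upper hσ' (σ⁻¹ • Z + B X) (σ⁻¹ • Z + B Y)) hσ.le
    have h2 : ‖σ⁻¹ • Z + B Y - (σ⁻¹ • Z + B X)‖ ^ 2 ≤ ‖B‖ ^ 2 * ‖Y - X‖ ^ 2 := by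
      rw [add_sub_add_left_eq_sub, ← map_sub, ← mul_pow]
      gcongr
      exact B.le_opNorm _
    have h3 := mul_le_mul_of_nonneg_left h2 hσ.le
    linarith
  · set x := σ⁻¹ • Z + B X with hx
    set y := σ⁻¹ • Z + B Y with hy
    have h1 : phiGradient A B D p σ Z X - phiGradient A B D p σ Z Y
        = (X - Y) + σ • ContinuousLinearMap.adjoint B
          ((x - y) - (prox D p σ⁻¹ x - prox D p σ⁻¹ y)) := by
      simp only [phiGradient, map_sub, ← hx, ← hy]
      module
    have h2 : ‖(x - y) - (prox D p σ⁻¹ x - prox D p σ⁻¹ y)‖ ≤ ‖B‖ * ‖X - Y‖ := by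
      have h3 : ‖x - y‖ ≤ ‖B‖ * ‖X - Y‖ := by
        rw [hx, hy, add_sub_add_left_eq_sub, ← map_sub]
        exact B.le_opNorm _
      -- Firm nonexpansiveness of `prox` makes `id - prox` nonexpansive.
      refine le_trans (abs_le_of_sq_le_sq' ?_ (norm_nonneg _)).2 h3
      rw [norm_sub_sq_real, real_inner_comm]
      have := hp.prox_firmlyNonexpansive hσ' x y
      have : 0 ≤ ‖prox D p σ⁻¹ x - prox D p σ⁻¹ y‖ ^ 2 := by positivity
      linarith
    rw [h1]
    refine (norm_add_le _ _).trans ?_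
    rw [norm_smul, Real.norm_eq_abs, abs_of_pos hσ]
    have h4 := (ContinuousLinearMap.adjoint B).le_opNorm
      ((x - y) - (prox D p σ⁻¹ x - prox D p σ⁻¹ y))
    rw [LinearIsometryEquiv.norm_map] at h4
    have h5 := mul_le_mul_of_nonneg_left
      (h4.trans (mul_le_mul_of_nonneg_left h2 (norm_nonneg B))) hσ.le
    linarith

theorem symmetricBetween_of_mem_genHessian (hp : ClosedProperConvex D p) (hσ : 0 < σ) {X : E}
    {V : E →L[ℝ] E} (hV : V ∈ genHessian B D p σ Z X) :
    SymmetricBetween V (1 + σ * ‖B‖ ^ 2) := by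
  obtain ⟨P, hP, rfl⟩ := hV
  obtain ⟨hsymm, hbd⟩ := hp.clarkeJacobian_prox (inv_pos.2 hσ) hP
  have hquad : ∀ d, inner ℝ d ((ContinuousLinearMap.id ℝ E + σ •
      ((ContinuousLinearMap.adjoint B).comp ((ContinuousLinearMap.id ℝ F - P).comp B))) d)
      = ‖d‖ ^ 2 + σ * (‖B d‖ ^ 2 - inner ℝ (B d) (P (B d))) := by
    intro d
    simp [inner_add_right, inner_smul_right, ContinuousLinearMap.adjoint_inner_right,
      inner_sub_right]
  refine ⟨fun v w => ?_, fun d => ?_, fun d => ?_⟩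
  · simp [inner_add_left, inner_add_right, inner_smul_left, inner_smul_right,
      ContinuousLinearMap.adjoint_inner_right, ContinuousLinearMap.adjoint_inner_left,
      inner_sub_left, inner_sub_right, hsymm]
  · rw [hquad]
    have := mul_nonneg hσ.le (sub_nonneg.2 (hbd (B d)).2)
    linarith
  · rw [hquad]
    have h1 : ‖B d‖ ^ 2 - inner ℝ (B d) (P (B d)) ≤ ‖B‖ ^ 2 * ‖d‖ ^ 2 := by
      rw [← mul_pow]
      have : ‖B d‖ ^ 2 ≤ (‖B‖ * ‖d‖) ^ 2 := by gcongr; exact B.le_opNorm d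
      linarith [(hbd (B d)).1]
    have := mul_le_mul_of_nonneg_left h1 hσ.le
    linarith

theorem directionallyDifferentiableAt_phiGradient {X : E}
    (h : DirectionallyDifferentiableAt (prox D p σ⁻¹) (σ⁻¹ • Z + B X)) :
    DirectionallyDifferentiableAt (phiGradient A B D p σ Z) X := by
  intro v
  obtain ⟨y, hy⟩ := h (B v)
  refine ⟨v + σ • ContinuousLinearMap.adjoint B (B v - y), ?_⟩
  have h1 := (((ContinuousLinearMap.adjoint B).continuous.tendsto _).comp
    (hy.const_sub (B v))).const_smul σ |>.const_add v
  refine h1.congr' (eventually_mem_nhdsWithin.mono fun t ht => ?_)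
  have ht0 : t ≠ 0 := ne_of_gt ht
  have h2 : σ⁻¹ • Z + B (X + t • v) = σ⁻¹ • Z + B X + t • B v := by
    rw [map_add, map_smul, add_assoc]
  have h3 : phiGradient A B D p σ Z (X + t • v) - phiGradient A B D p σ Z X
      = t • v + σ • ContinuousLinearMap.adjoint B (t • B v -
        (prox D p σ⁻¹ (σ⁻¹ • Z + B X + t • B v) - prox D p σ⁻¹ (σ⁻¹ • Z + B X))) := by
    rw [phiGradient, phiGradient, h2]
    simp only [map_sub, map_add]
    module
  simp only [Function.comp_apply]
  rw [h3, smul_add, smul_smul, inv_mul_cancel₀ ht0, one_smul, smul_comm t⁻¹ σ,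
    ← map_smul (ContinuousLinearMap.adjoint B) t⁻¹,
    smul_sub t⁻¹ (t • B v), smul_smul t⁻¹ t, inv_mul_cancel₀ ht0, one_smul]

/-- The affine parts of the gradient cancel exactly against `V`, leaving `-σ B* e` with `e` the
semismooth remainder of `prox` in direction `B(Y - Xbar)`. -/
theorem norm_phiGradient_sub_le (hσ : 0 < σ) {Xbar : E}
    (hXbar : phiGradient A B D p σ Z Xbar = 0)
    (h : StronglySemismoothAt (prox D p σ⁻¹) (σ⁻¹ • Z + B Xbar)) :
    ∃ C : ℝ, ∃ r > 0, ∀ Y, ‖Y - Xbar‖ < r → ∀ V ∈ genHessian B D p σ Z Y,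
      ‖phiGradient A B D p σ Z Y - V (Y - Xbar)‖ ≤ C * ‖Y - Xbar‖ ^ 2 := by
  obtain ⟨-, C, r, hr, hC⟩ := h
  -- The `+ 1` keeps the radius meaningful when `B = 0`.
  refine ⟨σ * (‖B‖ * (|C| * ‖B‖ ^ 2)), r / (‖B‖ + 1), by positivity, fun Y hY V hV => ?_⟩
  obtain ⟨P, hP, rfl⟩ := hV
  have hBY : ‖B (Y - Xbar)‖ ≤ ‖B‖ * ‖Y - Xbar‖ := B.le_opNorm _
  have hsmall : ‖B (Y - Xbar)‖ < r := by
    rw [lt_div_iff₀ (by positivity)] at hY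
    have := norm_nonneg (Y - Xbar)
    linarith
  have hx : σ⁻¹ • Z + B Xbar + B (Y - Xbar) = σ⁻¹ • Z + B Y := by rw [map_sub]; abel
  have h1 := hC (B (Y - Xbar)) hsmall P (by rwa [hx])
  rw [hx] at h1
  set e := prox D p σ⁻¹ (σ⁻¹ • Z + B Y) - prox D p σ⁻¹ (σ⁻¹ • Z + B Xbar) - P (B (Y - Xbar))
    with he
  have h2 : phiGradient A B D p σ Z Y - (ContinuousLinearMap.id ℝ E + σ •
      ((ContinuousLinearMap.adjoint B).comp ((ContinuousLinearMap.id ℝ F - P).comp B)))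
        (Y - Xbar) = -(σ • ContinuousLinearMap.adjoint B e) := by
    rw [← sub_zero (phiGradient A B D p σ Z Y), ← hXbar]
    simp only [phiGradient, he, map_sub, map_add, add_apply, smul_apply, sub_apply,
      ContinuousLinearMap.comp_apply, ContinuousLinearMap.id_apply]
    module
  rw [h2, norm_neg, norm_smul, Real.norm_eq_abs, abs_of_pos hσ, mul_assoc]
  have h3 := (ContinuousLinearMap.adjoint B).le_opNorm e
  rw [LinearIsometryEquiv.norm_map] at h3
  have h4 : ‖e‖ ≤ |C| * ‖B‖ ^ 2 * ‖Y - Xbar‖ ^ 2 := by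
    refine h1.trans ?_
    rw [mul_assoc, ← mul_pow]
    gcongr
    exact le_abs_self C
  refine mul_le_mul_of_nonneg_left (h3.trans ?_) hσ.le
  rw [mul_assoc]
  exact mul_le_mul_of_nonneg_left h4 (norm_nonneg B)

end AugmentedLagrangian

end SSNCG

theorem theorem2 (d n : ℕ) (𝓔 : Finset (Fin n × Fin n))
    (A : SSNCG.ColMatrix d (Fin n)) (Z : SSNCG.ColMatrix d 𝓔)
    (σ : ℝ) (hσ : 0 < σ)
    (D : Set (SSNCG.ColMatrix d 𝓔)) (p : SSNCG.ColMatrix d 𝓔 → ℝ)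
    (hp : SSNCG.ClosedProperConvex D p)
    (hss : SSNCG.StronglySemismoothOn (SSNCG.prox D p σ⁻¹) (interior D))
    (μ τ η δ : ℝ) (hμ : μ ∈ Set.Ioo (0 : ℝ) (1 / 2)) (hτ : τ ∈ Set.Ioc (0 : ℝ) 1)
    (hη : η ∈ Set.Ioo (0 : ℝ) 1) (hδ : δ ∈ Set.Ioo (0 : ℝ) 1)
    (X : ℕ → SSNCG.ColMatrix d (Fin n))
    (hX : ∀ j, SSNCG.SSNCGStep (SSNCG.phi A (SSNCG.edgeDiff d 𝓔) D p σ Z)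
      (SSNCG.genHessian (SSNCG.edgeDiff d 𝓔) D p σ Z) μ τ η δ (X j) (X (j + 1))) :
    Differentiable ℝ (SSNCG.phi A (SSNCG.edgeDiff d 𝓔) D p σ Z) ∧
    ∃ Xbar : SSNCG.ColMatrix d (Fin n),
      (∀ Y, gradient (SSNCG.phi A (SSNCG.edgeDiff d 𝓔) D p σ Z) Y = 0 ↔ Y = Xbar) ∧
      Tendsto X atTop (𝓝 Xbar) ∧
      (σ⁻¹ • Z + SSNCG.edgeDiff d 𝓔 Xbar ∈ interior D →
        (fun j => ‖X (j + 1) - Xbar‖) =O[atTop] (fun j => ‖X j - Xbar‖ ^ (1 + τ))) := by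
  set B := SSNCG.edgeDiff d 𝓔
  have hf := SSNCG.smoothStrongConvex_phi (A := A) (B := B) (Z := Z) hp hσ
  have hH : ∀ Y, ∀ V ∈ SSNCG.genHessian B D p σ Z Y,
      SSNCG.SymmetricBetween V (1 + σ * ‖B‖ ^ 2) := fun Y V hV =>
    SSNCG.symmetricBetween_of_mem_genHessian hp hσ hV
  obtain ⟨Xbar, hXbar⟩ := hf.exists_zero
  have hlim := hf.tendsto_zero hH ⟨hμ.1, hμ.2.trans (by norm_num)⟩ hτ.1 hη.2 hδ hX hXbar
  refine ⟨fun Y => (hf.hasGradientAt Y).differentiableAt, Xbar, fun Y => ?_, hlim, fun hint => ?_⟩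
  · rw [(hf.hasGradientAt Y).gradient]
    refine ⟨fun hY => ?_, fun hY => hY ▸ hXbar⟩
    have h := hf.norm_sub_le Y Xbar
    rw [hY, hXbar, sub_zero, norm_zero] at h
    exact sub_eq_zero.1 (norm_le_zero_iff.1 h)
  · have hs := hss.2 _ hint
    obtain ⟨C, r, hr, hC⟩ := SSNCG.norm_phiGradient_sub_le hσ hXbar hs
    exact hf.isBigO_rate hH hμ hτ hX hXbar hlim
      (SSNCG.directionallyDifferentiableAt_phiGradient hs.1.1) hr hC
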